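/- Let $\mathbf M$ be the set of Borel probability measures $\mu$ on $\mathbf R_+=[0,\infty)$ whose mean $m_\mu=\int x\,\mathrm d\mu(x)$ is finite and nonzero. For $\mu\in\mathbf M$ with cumulative distribution function $F_\mu(q)=\mu([0,q])$, let $Q_\mu(p)=\min\{q\in\mathbf R_+ : F_\mu(q)\ge p\}$ $(0\le p<1)$ be its quantile function and $$L_\mu(p)=\frac{\int_0^pQ_\mu(t)\,\mathrm dt}{\int_0^1Q_\mu(t)\,\mathrm dt}\qquad(p\in[0,1])$$ its Lorenz function. Endow $\mathbf M$ with the metric $\mathrm W_1(\mu,\nu)=\int_0^1|Q_\mu(t)-Q_\nu(t)|\,\mathrm dt$ and $\mathbf R_+^*=(0,\infty)$ with its usual topology. Let $\mathfrak L$ be the set of continuous convex functions $\ell:[0,1]\to[0,1]$ with $\ell(0)=0$ and $\ell(1)=1$. Write $\mu\equiv\nu$ if $\mu$ is the image of $\nu$ under $x\mapsto\alpha x$ for some $\alpha>0$; let $[\mu]\subseteq\mathbf M$ be the equivalence class of $\mu$, let $\mathbf M/\mathbf R_+^*$ be the set of these classes with the quotient topology, and for $\alpha>0$ let $\mathbf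 M_\alpha=\{\mu\in\mathbf M: m_\mu=\alpha\}$. The sets $[\mu]$ and $\mathbf M_\alpha$ carry the topology induced by $\mathrm W_1$. Theorem. 1. The map $\mu\mapsto(L_\mu,m_\mu)$ is a homeomorphism from $(\mathbf M,\mathrm W_1)$ onto $(\mathfrak L,\|\cdot\|_\infty)\times\mathbf R_+^*$. 2. The same map is a homeomorphism from $(\mathbf M,\mathrm W_1)$ onto $\mathfrak L\times\mathbf R_+^*$ when $\mathfrak L$ carries the topology of pointwise convergence. 3. For all real $a\le b$, the $\|\cdot\|_\infty$ topology (uniform convergence) and the product topology (pointwise convergence) on $\mathbf R^{[a,b]}$ induce the same topology on the set of continuous nondecreasing functions $[a,b]\to\mathbf R$; moreover every element of $\mathfrak L$ is continuous and nondecreasing on $[0,1]$. 4. With $\mathfrak L$ carrying the $\|\cdot\|_\infty$ topology, the following maps are (well defined and) homeomorphisms: - $\mathbf M/\mathbf R_+^*\to\mathfrak L$, $[\mu]\mapsto L_\mu$; - $\mathbf M\to\mathbf M/\mathbf R_+^*\times\mathbf R_+^*$, $\mu\mapsto([\mu],m_\mu)$; - for every $\alpha>0$, $\mathbf M_\alpha\to\mathbf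 M/\mathbf R_+^*$, $\mu\mapsto[\mu]$; - for every $\mu\in\mathbf M$, $[\mu]\to\mathbf R_+^*$, $\nu\mapsto m_\nu$. -/

import Mathlib

open scoped NNReal ENNReal Topology

noncomputable section

namespace Lorenz

open MeasureTheory Set

/-- The mean `m_μ = ∫ x dμ(x) ∈ [0, ∞]` of a measure on `ℝ₊`. -/
def mean (μ : Measure ℝ≥0) : ℝ≥0∞ := ∫⁻ x, (x : ℝ≥0∞) ∂μ

/-- The cumulative distribution function `F_μ(q) = μ([0, q])`. -/
def cdf (μ : Measure ℝ≥0) (q : ℝ≥0) : ℝ := μ.real (Iic q)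

/-- The quantile function `Q_μ(p) = min {q ∈ ℝ₊ : F_μ(q) ≥ p}`, meaningful for `p ∈ [0, 1)`. -/
def quantile (μ : Measure ℝ≥0) (p : ℝ) : ℝ≥0 := sInf {q : ℝ≥0 | p ≤ cdf μ q}

/-- The set `𝐌` of probability distributions on `ℝ₊` with nonzero and finite mean. -/
@[ext]
structure Dist where
  /-- The underlying Borel measure on `ℝ₊`. -/
  toMeasure : Measure ℝ≥0
  isProb : IsProbabilityMeasure toMeasure
  mean_ne_zero : mean toMeasure ≠ 0
  mean_ne_top : mean toMeasure ≠ ∞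

/-! ### Basic facts on quantile functions (used to build the metric `W₁`) -/

lemma cdf_mono (μ : Measure ℝ≥0) [IsProbabilityMeasure μ] : Monotone (cdf μ) :=
  fun _ _ h => measureReal_mono (Iic_subset_Iic.2 h)

lemma quantile_nonempty (μ : Measure ℝ≥0) [IsProbabilityMeasure μ] {p : ℝ} (hp : p < 1) :
    {q : ℝ≥0 | p ≤ cdf μ q}.Nonempty := by
  have h : Filter.Tendsto (fun q : ℝ≥0 => μ (Iic q)) Filter.atTop (𝓝 (μ univ)) :=
    tendsto_measure_Iic_atTop μ
  have h' : Filter.Tendsto (cdf μ) Filter.atTop (𝓝 1) := by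
    have := (ENNReal.tendsto_toReal (measure_ne_top μ univ)).comp h
    rw [measure_univ, ENNReal.toReal_one] at this
    exact this
  obtain ⟨q, hq⟩ := (h'.eventually (lt_mem_nhds hp)).exists
  exact ⟨q, hq.le⟩

lemma le_cdf_quantile (μ : Measure ℝ≥0) [IsProbabilityMeasure μ] {p : ℝ} (hp : p < 1) :
    p ≤ cdf μ (quantile μ p) := by
  obtain ⟨u, hanti, hu_lim, hu_mem⟩ :=
    exists_seq_tendsto_sInf (quantile_nonempty μ hp) (OrderBot.bddBelow _)
  have hI : ⋂ n, Iic (u n) = Iic (quantile μ p) := by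
    ext x
    simp only [mem_iInter, mem_Iic]
    exact ⟨fun h => ge_of_tendsto' hu_lim h,
      fun h n => h.trans (csInf_le (OrderBot.bddBelow _) (hu_mem n))⟩
  have h1 : Filter.Tendsto (fun n => μ (Iic (u n))) Filter.atTop (𝓝 (μ (⋂ n, Iic (u n)))) :=
    tendsto_measure_iInter_atTop (fun n => measurableSet_Iic.nullMeasurableSet)
      (fun _ _ h => Iic_subset_Iic.2 (hanti h)) ⟨0, measure_ne_top _ _⟩
  rw [hI] at h1
  have h2 := (ENNReal.tendsto_toReal (measure_ne_top μ (Iic (quantile μ p)))).comp h1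
  exact ge_of_tendsto' h2 (fun n => hu_mem n)

lemma quantile_le_iff (μ : Measure ℝ≥0) [IsProbabilityMeasure μ] {p : ℝ} (hp : p < 1) (q : ℝ≥0) :
    quantile μ p ≤ q ↔ p ≤ cdf μ q :=
  ⟨fun h => (le_cdf_quantile μ hp).trans (cdf_mono μ h),
    fun h => csInf_le (OrderBot.bddBelow _) h⟩

lemma quantile_monotoneOn (μ : Measure ℝ≥0) [IsProbabilityMeasure μ] :
    MonotoneOn (quantile μ) (Ioo 0 1) := fun _ ha _ hb h =>
  (quantile_le_iff μ ha.2 _).2 (h.trans (le_cdf_quantile μ hb.2))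

lemma aemeasurable_quantile (μ : Measure ℝ≥0) [IsProbabilityMeasure μ] :
    AEMeasurable (quantile μ) (volume.restrict (Ioo 0 1)) :=
  aemeasurable_restrict_of_monotoneOn measurableSet_Ioo (quantile_monotoneOn μ)

lemma map_quantile (μ : Measure ℝ≥0) [IsProbabilityMeasure μ] :
    (volume.restrict (Ioo (0 : ℝ) 1)).map (quantile μ) = μ := by
  refine (Measure.ext_of_Iic _ _ fun q => ?_).symm
  rw [Measure.map_apply_of_aemeasurable (aemeasurable_quantile μ) measurableSet_Iic,
    Measure.restrict_apply' measurableSet_Ioo]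
  have hF : cdf μ q ≤ 1 := measureReal_le_one
  have hset : quantile μ ⁻¹' Iic q ∩ Ioo (0 : ℝ) 1 = Iic (cdf μ q) ∩ Ioo 0 1 := by
    ext p
    simp only [mem_inter_iff, mem_preimage, mem_Iic]
    exact and_congr_left fun hp => quantile_le_iff μ hp.2 q
  have hae : (Iic (cdf μ q) ∩ Ioo (0 : ℝ) 1 : Set ℝ) =ᵐ[volume] Ioc 0 (cdf μ q) := by
    have h1 : (Iic (cdf μ q) ∩ Ioo (0 : ℝ) 1 : Set ℝ) =ᵐ[volume]
        (Iic (cdf μ q) ∩ Ioc (0 : ℝ) 1 : Set ℝ) :=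
      (Filter.EventuallyEq.refl _ _).inter Ioo_ae_eq_Ioc
    have h2 : (Iic (cdf μ q) ∩ Ioc (0 : ℝ) 1 : Set ℝ) = Ioc 0 (cdf μ q) := by
      ext p
      simp only [mem_inter_iff, mem_Iic, mem_Ioc]
      exact ⟨fun h => ⟨h.2.1, h.1⟩, fun h => ⟨h.2, h.1, h.2.trans hF⟩⟩
    rwa [h2] at h1
  rw [hset, measure_congr hae, Real.volume_Ioc, sub_zero, cdf, Measure.real,
    ENNReal.ofReal_toReal (measure_ne_top _ _)]

namespace Dist

instance (μ : Dist) : IsProbabilityMeasure μ.toMeasure := μ.isProb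

/-- The mean `m_μ` of `μ ∈ 𝐌`, as an element of `ℝ₊* = (0, ∞)`. -/
def m (μ : Dist) : Ioi (0 : ℝ) :=
  ⟨(mean μ.toMeasure).toReal, ENNReal.toReal_pos μ.mean_ne_zero μ.mean_ne_top⟩

/-- The quantile function `Q_μ` of `μ ∈ 𝐌`. -/
def Q (μ : Dist) (p : ℝ) : ℝ := quantile μ.toMeasure p

/-- The Lorenz function `L_μ(p) = (∫₀^p Q_μ) / (∫₀^1 Q_μ)` on `[0, 1]`. -/
def L (μ : Dist) (p : Icc (0 : ℝ) 1) : ℝ :=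
  (∫ t in (0 : ℝ)..p, μ.Q t) / ∫ t in (0 : ℝ)..1, μ.Q t

/-- The Wasserstein distance `W₁(μ, ν) = ∫₀^1 |Q_μ(t) - Q_ν(t)| dt`. -/
def W₁ (μ ν : Dist) : ℝ := ∫ t in (0 : ℝ)..1, |μ.Q t - ν.Q t|

lemma integrable_Q (μ : Dist) : Integrable μ.Q (volume.restrict (Ioo 0 1)) := by
  have hm := aemeasurable_quantile μ.toMeasure
  refine ⟨(measurable_coe_nnreal_real.comp_aemeasurable hm).aestronglyMeasurable, ?_⟩
  have h : ∫⁻ t in Ioo (0 : ℝ) 1, (quantile μ.toMeasure t : ℝ≥0∞) = mean μ.toMeasure := by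
    conv_rhs => rw [mean, ← map_quantile μ.toMeasure]
    rw [lintegral_map' measurable_coe_nnreal_ennreal.aemeasurable hm]
  rw [HasFiniteIntegral]
  calc ∫⁻ t in Ioo (0 : ℝ) 1, ‖μ.Q t‖ₑ
      = ∫⁻ t in Ioo (0 : ℝ) 1, (quantile μ.toMeasure t : ℝ≥0∞) := by
        refine lintegral_congr fun t => ?_
        simp [Q, enorm]
    _ < ∞ := by rw [h]; exact μ.mean_ne_top.lt_top

lemma W₁_eq (μ ν : Dist) : W₁ μ ν = ∫ t in Ioo (0 : ℝ) 1, |μ.Q t - ν.Q t| := by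
  rw [W₁, intervalIntegral.integral_of_le zero_le_one, integral_Ioc_eq_integral_Ioo]

lemma integrable_abs_sub (μ ν : Dist) :
    Integrable (fun t => |μ.Q t - ν.Q t|) (volume.restrict (Ioo 0 1)) :=
  (μ.integrable_Q.sub ν.integrable_Q).abs

/-- `𝐌` is a metric space for the distance `W₁`. -/
instance : MetricSpace Dist where
  dist := W₁
  dist_self μ := by simp [W₁]
  dist_comm μ ν := by simp only [W₁, abs_sub_comm]
  dist_triangle μ ν ρ := by
    rw [W₁_eq, W₁_eq, W₁_eq, ← integral_add (integrable_abs_sub μ ν) (integrable_abs_sub ν ρ)]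
    exact integral_mono (integrable_abs_sub μ ρ)
      ((integrable_abs_sub μ ν).add (integrable_abs_sub ν ρ)) fun t => abs_sub_le _ _ _
  eq_of_dist_eq_zero {μ ν} h := by
    change W₁ μ ν = 0 at h
    rw [W₁_eq, integral_eq_zero_iff_of_nonneg (fun t => abs_nonneg _)
      (integrable_abs_sub μ ν)] at h
    have h' : quantile μ.toMeasure =ᵐ[volume.restrict (Ioo 0 1)] quantile ν.toMeasure := by
      filter_upwards [h] with t ht
      exact NNReal.coe_injective (sub_eq_zero.1 (abs_eq_zero.1 ht))
    ext1
    rw [← map_quantile μ.toMeasure, ← map_quantile ν.toMeasure, Measure.map_congr h']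

/-- The set `𝐌_α` of distributions with mean `α`. -/
def withMean (α : Ioi (0 : ℝ)) : Set Dist := {μ | μ.m = α}

/-- Equality up to a rescaling: `μ ≡ ν` iff `μ = (S_α)_♯ ν` for some `α > 0`, where
`S_α(x) = α x`. -/
instance rescaling : Setoid Dist where
  r μ ν := ∃ α : ℝ≥0, 0 < α ∧ μ.toMeasure = ν.toMeasure.map (fun x => α * x)
  iseqv :=
    { refl := fun μ => ⟨1, one_pos, by simp⟩
      symm := by
        rintro μ ν ⟨α, hα, h⟩
        refine ⟨α⁻¹, inv_pos.2 hα, ?_⟩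
        rw [h, Measure.map_map (by fun_prop) (by fun_prop)]
        have : (fun x : ℝ≥0 => α⁻¹ * x) ∘ (fun x => α * x) = id := by
          ext1 x
          simp [inv_mul_cancel_left₀ hα.ne']
        rw [this, Measure.map_id]
      trans := by
        rintro μ ν ρ ⟨α, hα, h⟩ ⟨β, hβ, h'⟩
        refine ⟨α * β, mul_pos hα hβ, ?_⟩
        rw [h, h', Measure.map_map (by fun_prop) (by fun_prop)]
        congr 1
        ext1 x
        simp [mul_assoc] }

/-- The quotient `𝐌 / ℝ₊*`, which carries the quotient topology of the `W₁` topology. -/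
abbrev Classes : Type := Quotient rescaling

/-- The equivalence class `[μ] ⊆ 𝐌`. -/
def cls (μ : Dist) : Set Dist := {ν | ν ≈ μ}

end Dist

/-- The set `𝔏` of continuous convex functions `ℓ : [0, 1] → [0, 1]` with `ℓ(0) = 0` and
`ℓ(1) = 1`. As a subspace of `[0, 1] → ℝ`, it carries the topology of pointwise convergence. -/
def lorenzSet : Set (Icc (0 : ℝ) 1 → ℝ) :=
  {ℓ | (∀ x, ℓ x ∈ Icc (0 : ℝ) 1) ∧ Continuous ℓ ∧
    ConvexOn ℝ (Icc (0 : ℝ) 1) (IccExtend zero_le_one ℓ) ∧ ℓ 0 = 0 ∧ ℓ 1 = 1}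

/-- A set of real functions on `X`, seen in the space `X →ᵤ ℝ` of all real functions on `X` with
the `‖·‖_∞` topology (the topology of uniform convergence, whose extended distance is
`⨆ x, |f x - g x|`). -/
def unif {X : Type*} (S : Set (X → ℝ)) : Set (UniformFun X ℝ) := UniformFun.toFun ⁻¹' S

/-- The set `𝒞↑` of continuous nondecreasing real functions on `[a, b]`. -/
def contMono (a b : ℝ) : Set (Icc a b → ℝ) := {f | Continuous f ∧ Monotone f}

end Lorenz

end

noncomputable section

namespace Lorenz

open MeasureTheory Set

/-! The mean and the Lorenz function together encode the primitive of the quantile function, since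
the integral of `Q_μ` over `[0, p]` is `m_μ L_μ(p)`. As `W₁` is the `L¹` distance of quantile
functions, the crux is that nonnegative nondecreasing functions on `(0, 1)` converge in `L¹` as soon
as their primitives converge at each point of `[0, 1]`.

On one cell of a uniform subdivision, the `L¹` distance is at most the difference of the integrals
plus the width times the oscillations. Summed over the cells, the oscillations telescope, and the
remainder is absorbed by the integrals over the last cell (`integral_abs_sub_le_sum`). This one
estimate gives injectivity (`ae_eq_of_primitive_eq`) and continuity of the inverse
(`tendsto_of_L_of_m`).

For surjectivity, the right derivative of `ℓ`, multiplied by the desired mean, is nondecreasing by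
convexity; pushing Lebesgue measure forward along it gives the distribution (`exists_dist`). Pólya's
argument (`continuous_ofFun_contMono`) identifies the two topologies on `𝔏`. Finally, `L` is a
complete invariant for rescaling, so classes, fixed-mean sets and single orbits become the factors
and slices of `𝔏 × ℝ₊*`. -/

/-! ### `L¹` distance of nondecreasing functions and their primitives -/

/-- On an interval, the `L¹` distance of two nondecreasing functions is controlled by the difference
of their integrals and by their oscillations. -/
lemma integral_abs_sub_le_of_monotoneOn {f g : ℝ → ℝ} {a b : ℝ} (hab : a < b)
    (hf : MonotoneOn f (Icc a b)) (hg : MonotoneOn g (Icc a b)) :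
    ∫ t in a..b, |f t - g t| ≤ |(∫ t in a..b, f t) - ∫ t in a..b, g t| +
      (b - a) * ((f b - f a) + (g b - g a)) := by
  have hu : uIcc a b = Icc a b := uIcc_of_le hab.le
  have hfi : IntervalIntegrable f volume a b := MonotoneOn.intervalIntegrable (hu ▸ hf)
  have hgi : IntervalIntegrable g volume a b := MonotoneOn.intervalIntegrable (hu ▸ hg)
  have hfg := hfi.sub hgi
  set D := (∫ t in a..b, f t) - ∫ t in a..b, g t with hD
  set O := (f b - f a) + (g b - g a)
  have hDi : ∫ t in a..b, (f t - g t) = D := intervalIntegral.integral_sub hfi hgi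
  have ha : a ∈ Icc a b := left_mem_Icc.2 hab.le
  have hb : b ∈ Icc a b := right_mem_Icc.2 hab.le
  have hosc : ∀ s ∈ Icc a b, ∀ t ∈ Icc a b, f s - g s ≤ f t - g t + O := by
    intro s hs t ht
    have h1 := hf hs hb hs.2
    have h2 := hf ha ht ht.1
    have h3 := hg ha hs hs.1
    have h4 := hg ht hb ht.2
    simp only [O]
    linarith
  -- `D / (b - a)` is the mean of `f - g`, and by `hosc` no value of `f - g` is farther than `O`
  -- from it.
  have hpt : ∀ t ∈ Icc a b, |f t - g t| ≤ |D| / (b - a) + O := by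
    intro t ht
    have h1 : D ≤ (b - a) * (f t - g t + O) := by
      rw [← hDi, ← smul_eq_mul, ← intervalIntegral.integral_const]
      exact intervalIntegral.integral_mono_on hab.le hfg (by simp) fun s hs => hosc s hs t ht
    have h2 : (b - a) * (f t - g t - O) ≤ D := by
      rw [← hDi, ← smul_eq_mul, ← intervalIntegral.integral_const]
      refine intervalIntegral.integral_mono_on hab.le (by simp) hfg fun s hs => ?_
      linarith [hosc t ht s hs]
    have hpos := sub_pos.2 hab
    rw [← sub_le_iff_le_add, le_div_iff₀ hpos, sub_mul, sub_le_iff_le_add, ← abs_of_pos hpos,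
      ← abs_mul, abs_of_pos hpos, abs_le]
    constructor <;> nlinarith [le_abs_self D, neg_abs_le D]
  calc ∫ t in a..b, |f t - g t| ≤ ∫ _ in a..b, (|D| / (b - a) + O) :=
        intervalIntegral.integral_mono_on hab.le hfg.abs (by simp) hpt
    _ = |D| + (b - a) * O := by
        rw [intervalIntegral.integral_const, smul_eq_mul, mul_add,
          mul_div_cancel₀ _ (sub_pos.2 hab).ne']

/-- The subdivision of `[0, 1]` in `n + 1` intervals of the same length. -/
def node (n i : ℕ) : ℝ := i / (n + 1)

lemma node_zero (n : ℕ) : node n 0 = 0 := by simp [node]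

lemma node_last (n : ℕ) : node n (n + 1) = 1 := by
  rw [node]; push_cast; exact div_self (by positivity)

lemma node_sub (n i : ℕ) : node n (i + 1) - node n i = 1 / (n + 1) := by
  rw [node, node]; push_cast; ring

lemma node_lt (n i : ℕ) : node n i < node n (i + 1) := by
  rw [← sub_pos, node_sub]; positivity

lemma node_mono (n : ℕ) : Monotone (node n) := monotone_nat_of_le_succ fun i => (node_lt n i).le

lemma node_nonneg (n i : ℕ) : 0 ≤ node n i := by rw [node]; positivity

lemma node_mem (n i : ℕ) (h : i ≤ n + 1) : node n i ∈ Icc (0 : ℝ) 1 :=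
  ⟨node_nonneg n i, node_last n ▸ node_mono n h⟩

lemma tendsto_node_self : Filter.Tendsto (fun n => node n n) Filter.atTop (𝓝 1) := by
  simpa [node] using tendsto_natCast_div_add_atTop (1 : ℝ)

lemma intervalIntegrable_of_integrable_Ioo {f : ℝ → ℝ}
    (hf : Integrable f (volume.restrict (Ioo 0 1))) {a b : ℝ} (ha : a ∈ Icc (0 : ℝ) 1)
    (hb : b ∈ Icc (0 : ℝ) 1) : IntervalIntegrable f volume a b := by
  have h : IntervalIntegrable f volume 0 1 :=
    (intervalIntegrable_iff_integrableOn_Ioo_of_le zero_le_one).2 hf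
  refine h.mono_set ?_
  rw [uIcc_of_le zero_le_one]
  exact uIcc_subset_Icc ha hb

/-- The `L¹` distance on `[0, 1]` of two nonnegative nondecreasing functions is controlled by
finitely many values of their primitives. -/
lemma integral_abs_sub_le_sum {f g : ℝ → ℝ}
    (hf : MonotoneOn f (Iio 1)) (hg : MonotoneOn g (Iio 1)) (hf0 : ∀ t, 0 ≤ f t)
    (hg0 : ∀ t, 0 ≤ g t) (hfi : Integrable f (volume.restrict (Ioo 0 1)))
    (hgi : Integrable g (volume.restrict (Ioo 0 1))) (n : ℕ) :
    ∫ t in (0 : ℝ)..1, |f t - g t| ≤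
      (∑ i ∈ Finset.range n, |(∫ t in node n i..node n (i + 1), f t) -
        ∫ t in node n i..node n (i + 1), g t|) +
      2 * (∫ t in node n n..1, f t) + 2 * ∫ t in node n n..1, g t := by
  have hn1 : node n n < 1 := node_last n ▸ node_lt n n
  have hI : ∀ i < n + 1, IntervalIntegrable (fun t => |f t - g t|) volume
      (node n i) (node n (i + 1)) := fun i hi =>
    (intervalIntegrable_of_integrable_Ioo (hfi.sub hgi) (node_mem n i hi.le)
      (node_mem n (i + 1) hi)).abs
  have hsum := intervalIntegral.sum_integral_adjacent_intervals hI
  rw [node_zero, node_last, Finset.sum_range_succ, node_last] at hsum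
  have hmem := node_mem n n n.le_succ
  have hone : (1 : ℝ) ∈ Icc (0 : ℝ) 1 := by simp
  have hfl := intervalIntegrable_of_integrable_Ioo hfi hmem hone
  have hgl := intervalIntegrable_of_integrable_Ioo hgi hmem hone
  -- Nothing is known at the endpoint `1`, and `f`, `g` may blow up there, so the last cell only
  -- gets the crude bound `|f - g| ≤ f + g`.
  have hlast : ∫ t in node n n..1, |f t - g t| ≤
      (∫ t in node n n..1, f t) + ∫ t in node n n..1, g t := by
    rw [← intervalIntegral.integral_add hfl hgl]
    refine intervalIntegral.integral_mono_on hn1.le (hfl.sub hgl).abs (hfl.add hgl) fun t _ => ?_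
    have h1 := hf0 t
    have h2 := hg0 t
    rw [abs_le]; constructor <;> linarith
  -- By monotonicity, the telescoped oscillation is paid for by the last cell; with `hlast` this
  -- explains the factors `2`.
  have htail : ∀ h : ℝ → ℝ, MonotoneOn h (Iio 1) →
      IntervalIntegrable h volume (node n n) 1 → (1 / ((n : ℝ) + 1)) * h (node n n) ≤
        ∫ t in node n n..1, h t := by
    intro h hh hi
    have hw : 1 / ((n : ℝ) + 1) = 1 - node n n := by rw [← node_sub n n, node_last]
    rw [hw, ← smul_eq_mul, ← intervalIntegral.integral_const]
    refine intervalIntegral.integral_mono_on_of_le_Ioo hn1.le (by simp) hi fun t ht => ?_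
    exact hh hn1 ht.2 ht.1.le
  have hmain : ∑ i ∈ Finset.range n, ∫ t in node n i..node n (i + 1), |f t - g t| ≤
      ∑ i ∈ Finset.range n, (|(∫ t in node n i..node n (i + 1), f t) -
        ∫ t in node n i..node n (i + 1), g t| + (1 / ((n : ℝ) + 1)) *
          ((f (node n (i + 1)) + g (node n (i + 1))) - (f (node n i) + g (node n i)))) := by
    refine Finset.sum_le_sum fun i hi => ?_
    have hlt : node n (i + 1) < 1 :=
      (node_mono n (Nat.succ_le_of_lt (Finset.mem_range.1 hi))).trans_lt hn1
    have hsub : Icc (node n i) (node n (i + 1)) ⊆ Iio 1 := fun t ht => ht.2.trans_lt hlt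
    refine (integral_abs_sub_le_of_monotoneOn (node_lt n i) (hf.mono hsub) (hg.mono hsub)).trans
      (le_of_eq ?_)
    rw [node_sub]
    ring
  rw [Finset.sum_add_distrib, ← Finset.mul_sum,
    Finset.sum_range_sub (fun i => f (node n i) + g (node n i)), mul_sub, mul_add] at hmain
  have h0 : 0 ≤ (1 / ((n : ℝ) + 1)) * (f (node n 0) + g (node n 0)) :=
    mul_nonneg (by positivity) (add_nonneg (hf0 _) (hg0 _))
  linarith [htail f hf hfl, htail g hg hgl]

/-- Makes the last-cell terms of `integral_abs_sub_le_sum` negligible, by continuity of the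
primitive at `1`. -/
lemma tendsto_tail {f : ℝ → ℝ} (hfi : Integrable f (volume.restrict (Ioo 0 1))) :
    Filter.Tendsto (fun n => ∫ t in node n n..1, f t) Filter.atTop (𝓝 0) := by
  have hone : (1 : ℝ) ∈ Icc (0 : ℝ) 1 := by simp
  have hzero : (0 : ℝ) ∈ Icc (0 : ℝ) 1 := by simp
  have hc : ContinuousOn (fun x => ∫ t in x..1, f t) (Icc 0 1) := by
    have := intervalIntegral.continuousOn_primitive_interval_left (f := f) (μ := volume)
      (a := 0) (b := 1) ?_
    · rwa [uIcc_of_le zero_le_one] at this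
    · rw [uIcc_of_le zero_le_one, integrableOn_Icc_iff_integrableOn_Ioo]
      exact hfi
  have h1 := (hc 1 hone).tendsto
  rw [intervalIntegral.integral_same] at h1
  refine h1.comp (tendsto_nhdsWithin_iff.2 ⟨tendsto_node_self, ?_⟩)
  exact Filter.Eventually.of_forall fun n => node_mem n n n.le_succ

/-- Nonnegative nondecreasing functions with the same primitive coincide almost everywhere. -/
lemma ae_eq_of_primitive_eq {f g : ℝ → ℝ}
    (hf : MonotoneOn f (Iio 1)) (hg : MonotoneOn g (Iio 1)) (hf0 : ∀ t, 0 ≤ f t)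
    (hg0 : ∀ t, 0 ≤ g t) (hfi : Integrable f (volume.restrict (Ioo 0 1)))
    (hgi : Integrable g (volume.restrict (Ioo 0 1)))
    (h : ∀ p ∈ Icc (0 : ℝ) 1, ∫ t in (0 : ℝ)..p, f t = ∫ t in (0 : ℝ)..p, g t) :
    f =ᵐ[volume.restrict (Ioo 0 1)] g := by
  have hz : (0 : ℝ) ∈ Icc (0 : ℝ) 1 := by simp
  have hle : ∫ t in (0 : ℝ)..1, |f t - g t| ≤ 0 := by
    have hlim : Filter.Tendsto (fun n => 2 * (∫ t in node n n..1, f t) +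
        2 * ∫ t in node n n..1, g t) Filter.atTop (𝓝 0) := by
      simpa using ((tendsto_tail hfi).const_mul 2).add ((tendsto_tail hgi).const_mul 2)
    refine ge_of_tendsto' hlim fun n => ?_
    refine (integral_abs_sub_le_sum hf hg hf0 hg0 hfi hgi n).trans (le_of_eq ?_)
    rw [Finset.sum_eq_zero, zero_add]
    intro i hi
    have hi' := Finset.mem_range.1 hi
    have m1 := node_mem n i (by omega)
    have m2 := node_mem n (i + 1) (by omega)
    rw [← intervalIntegral.integral_interval_sub_left
        (intervalIntegrable_of_integrable_Ioo hfi hz m2)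
        (intervalIntegrable_of_integrable_Ioo hfi hz m1),
      ← intervalIntegral.integral_interval_sub_left
        (intervalIntegrable_of_integrable_Ioo hgi hz m2)
        (intervalIntegrable_of_integrable_Ioo hgi hz m1), h _ m1, h _ m2, sub_self, abs_zero]
  rw [intervalIntegral.integral_of_le zero_le_one, integral_Ioc_eq_integral_Ioo] at hle
  have h0 := le_antisymm hle (integral_nonneg fun t => abs_nonneg _)
  have h1 := (integral_eq_zero_iff_of_nonneg (f := fun t => |f t - g t|) (fun t => abs_nonneg _)
    (hfi.sub hgi).abs).1 h0
  filter_upwards [h1] with t ht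
  exact sub_eq_zero.1 (abs_eq_zero.1 ht)

/-! ### Lorenz functions and their invariance under rescaling -/

lemma lintegral_quantile (μ : Measure ℝ≥0) [IsProbabilityMeasure μ] :
    ∫⁻ t in Ioo (0 : ℝ) 1, (quantile μ t : ℝ≥0∞) = mean μ := by
  conv_rhs => rw [mean, ← map_quantile μ]
  rw [lintegral_map' measurable_coe_nnreal_ennreal.aemeasurable (aemeasurable_quantile μ)]

namespace Dist

lemma Q_nonneg (μ : Dist) (t : ℝ) : 0 ≤ μ.Q t := NNReal.coe_nonneg _

/-- The half-line `Iio 1` contains the first node `0`, which `Ioo 0 1` does not; the value at `1`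
must be excluded, as an infimum over the empty set is `0`. -/
lemma Q_monotoneOn (μ : Dist) : MonotoneOn μ.Q (Iio 1) := fun _ _ _ hb h =>
  NNReal.coe_le_coe.2 ((quantile_le_iff μ.toMeasure (h.trans_lt hb) _).2
    (h.trans (le_cdf_quantile μ.toMeasure hb)))

lemma intervalIntegrable_Q (μ : Dist) {a b : ℝ} (ha : a ∈ Icc (0 : ℝ) 1)
    (hb : b ∈ Icc (0 : ℝ) 1) : IntervalIntegrable μ.Q volume a b :=
  intervalIntegrable_of_integrable_Ioo μ.integrable_Q ha hb

lemma integral_Q_eq_m (μ : Dist) : ∫ t in (0 : ℝ)..1, μ.Q t = μ.m := by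
  rw [intervalIntegral.integral_of_le zero_le_one, integral_Ioc_eq_integral_Ioo,
    integral_eq_lintegral_of_nonneg_ae (Filter.Eventually.of_forall μ.Q_nonneg)
      μ.integrable_Q.aestronglyMeasurable]
  simp only [Q, ENNReal.ofReal_coe_nnreal, lintegral_quantile]
  rfl

lemma m_pos (μ : Dist) : (0 : ℝ) < μ.m := μ.m.2

lemma L_eq (μ : Dist) (p : Icc (0 : ℝ) 1) : μ.L p = (∫ t in (0 : ℝ)..p, μ.Q t) / μ.m := by
  rw [L, integral_Q_eq_m]

lemma integral_Q_eq_mul (μ : Dist) (p : Icc (0 : ℝ) 1) :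
    ∫ t in (0 : ℝ)..p, μ.Q t = μ.m * μ.L p := by
  rw [L_eq, mul_div_cancel₀ _ μ.m_pos.ne']

lemma integral_Q_sub (μ : Dist) {a b : ℝ} (ha : a ∈ Icc (0 : ℝ) 1) (hb : b ∈ Icc (0 : ℝ) 1) :
    ∫ t in a..b, μ.Q t = μ.m * μ.L ⟨b, hb⟩ - μ.m * μ.L ⟨a, ha⟩ := by
  have hz : (0 : ℝ) ∈ Icc (0 : ℝ) 1 := by simp
  rw [← integral_Q_eq_mul, ← integral_Q_eq_mul, intervalIntegral.integral_interval_sub_left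
    (μ.intervalIntegrable_Q hz hb) (μ.intervalIntegrable_Q hz ha)]

/-- The Lorenz function belongs to `𝔏`. -/
lemma L_mem (μ : Dist) : μ.L ∈ lorenzSet := by
  have hz : (0 : ℝ) ∈ Icc (0 : ℝ) 1 := by simp
  have ho : (1 : ℝ) ∈ Icc (0 : ℝ) 1 := by simp
  have hm := μ.m_pos
  refine ⟨fun p => ⟨?_, ?_⟩, ?_, ?_, ?_, ?_⟩
  · rw [L_eq]
    exact div_nonneg (intervalIntegral.integral_nonneg p.2.1 fun t _ => μ.Q_nonneg t) hm.le
  · rw [L_eq, div_le_one hm, ← integral_Q_eq_m, ← sub_nonneg,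
      intervalIntegral.integral_interval_sub_left (μ.intervalIntegrable_Q hz ho)
      (μ.intervalIntegrable_Q hz p.2)]
    exact intervalIntegral.integral_nonneg p.2.2 fun t _ => μ.Q_nonneg t
  · have hc : ContinuousOn (fun x => ∫ t in (0 : ℝ)..x, μ.Q t) (Icc 0 1) := by
      have := intervalIntegral.continuousOn_primitive_interval' (μ.intervalIntegrable_Q hz ho)
        left_mem_uIcc
      rwa [uIcc_of_le zero_le_one] at this
    have : μ.L = fun p => (Icc (0 : ℝ) 1).domRestrict (fun x => ∫ t in (0 : ℝ)..x, μ.Q t) p / μ.m :=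
      funext μ.L_eq
    rw [this]
    exact hc.domRestrict.div_const _
  · refine convexOn_of_slope_mono_adjacent (convex_Icc 0 1) ?_
    intro x y z hx hz' hxy hyz
    have hy : y ∈ Icc (0 : ℝ) 1 := ⟨hx.1.trans hxy.le, hyz.le.trans hz'.2⟩
    have hy1 : y < 1 := hyz.trans_le hz'.2
    rw [IccExtend_of_mem _ _ hx, IccExtend_of_mem _ _ hy, IccExtend_of_mem _ _ hz']
    -- Convexity: the slopes of `L` on either side of `y` are separated by `Q y / m`.
    have h1 : ∫ t in x..y, μ.Q t ≤ (y - x) * μ.Q y := by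
      rw [← smul_eq_mul, ← intervalIntegral.integral_const]
      exact intervalIntegral.integral_mono_on hxy.le (μ.intervalIntegrable_Q hx hy) (by simp)
        fun t ht => μ.Q_monotoneOn (ht.2.trans_lt hy1) hy1 ht.2
    have h2 : (z - y) * μ.Q y ≤ ∫ t in y..z, μ.Q t := by
      rw [← smul_eq_mul, ← intervalIntegral.integral_const]
      exact intervalIntegral.integral_mono_on_of_le_Ioo hyz.le (by simp)
        (μ.intervalIntegrable_Q hy hz')
        fun t ht => μ.Q_monotoneOn hy1 (ht.2.trans_le hz'.2) ht.1.le
    rw [integral_Q_sub μ hx hy, ← mul_sub] at h1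
    rw [integral_Q_sub μ hy hz', ← mul_sub] at h2
    have h3 : ∀ u v w : ℝ, 0 < w → μ.m * u ≤ w * v → u / w ≤ v / μ.m := by
      intro u v w hw h
      rw [div_le_div_iff₀ hw hm]; linarith
    have h4 : ∀ u v w : ℝ, 0 < w → w * v ≤ μ.m * u → v / μ.m ≤ u / w := by
      intro u v w hw h
      rw [div_le_div_iff₀ hm hw]; linarith
    exact (h3 _ _ _ (sub_pos.2 hxy) h1).trans (h4 _ _ _ (sub_pos.2 hyz) h2)
  · rw [L_eq]; simp
  · rw [L_eq]; simp only [Icc.coe_one, integral_Q_eq_m]; exact div_self hm.ne'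

/-- Distributions with the same Lorenz function are rescalings of one another by the ratio of
their means. -/
lemma toMeasure_eq_map_of_L_eq {μ ν : Dist} (h : μ.L = ν.L) {c : ℝ≥0}
    (hc : (c : ℝ) = μ.m / ν.m) : μ.toMeasure = ν.toMeasure.map (fun x => c * x) := by
  have hae : μ.Q =ᵐ[volume.restrict (Ioo 0 1)] fun t => c * ν.Q t := by
    refine ae_eq_of_primitive_eq μ.Q_monotoneOn
      (fun a ha b hb hab => mul_le_mul_of_nonneg_left (ν.Q_monotoneOn ha hb hab) c.2) μ.Q_nonneg
      (fun t => mul_nonneg c.2 (ν.Q_nonneg t)) μ.integrable_Q (ν.integrable_Q.const_mul _) ?_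
    intro p hp
    rw [intervalIntegral.integral_const_mul, integral_Q_eq_mul μ ⟨p, hp⟩,
      integral_Q_eq_mul ν ⟨p, hp⟩, h, hc, ← mul_assoc, div_mul_cancel₀ _ ν.m_pos.ne']
  have hae' : quantile μ.toMeasure =ᵐ[volume.restrict (Ioo 0 1)]
      (fun x => c * x) ∘ quantile ν.toMeasure := by
    filter_upwards [hae] with t ht
    apply NNReal.coe_injective
    simpa [Q] using ht
  rw [← map_quantile μ.toMeasure, Measure.map_congr hae']
  conv_rhs => rw [← map_quantile ν.toMeasure]
  rw [AEMeasurable.map_map_of_aemeasurable (by fun_prop) (aemeasurable_quantile _)]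

lemma eq_of_L_eq_of_m_eq {μ ν : Dist} (h : μ.L = ν.L) (hm : μ.m = ν.m) : μ = ν := by
  ext1
  have := toMeasure_eq_map_of_L_eq h (c := 1) (by rw [hm, div_self ν.m_pos.ne']; rfl)
  simpa using this

lemma equiv_of_L_eq {μ ν : Dist} (h : μ.L = ν.L) : μ ≈ ν :=
  ⟨⟨μ.m / ν.m, (div_pos μ.m_pos ν.m_pos).le⟩, div_pos μ.m_pos ν.m_pos,
    toMeasure_eq_map_of_L_eq h rfl⟩

/-- Rescaling turns `F(q)` into `F(q / c)`; the equivalence `Q(t) ≤ q ↔ t ≤ F(q)` transfers this to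
quantiles. -/
lemma Q_of_map {μ ν : Dist} {c : ℝ≥0} (hc : 0 < c)
    (h : μ.toMeasure = ν.toMeasure.map (fun x => c * x)) {t : ℝ} (ht : t < 1) :
    μ.Q t = c * ν.Q t := by
  have hcdf : ∀ q, cdf μ.toMeasure q = cdf ν.toMeasure (q / c) := by
    intro q
    rw [cdf, cdf, h, map_measureReal_apply (by fun_prop) measurableSet_Iic]
    congr 1
    ext x
    simp [le_div_iff₀ hc, mul_comm]
  have : quantile μ.toMeasure t = c * quantile ν.toMeasure t := by
    refine eq_of_forall_ge_iff fun q => ?_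
    rw [quantile_le_iff _ ht, hcdf, ← quantile_le_iff _ ht, le_div_iff₀ hc, mul_comm]
  rw [Q, this, NNReal.coe_mul, Q]

/-- The Lorenz function is invariant under rescaling. -/
lemma L_eq_of_equiv {μ ν : Dist} (h : μ ≈ ν) : μ.L = ν.L := by
  obtain ⟨c, hc, h⟩ := h
  have hG : ∀ p ∈ Icc (0 : ℝ) 1, ∫ t in (0 : ℝ)..p, μ.Q t = c * ∫ t in (0 : ℝ)..p, ν.Q t := by
    intro p hp
    rw [← intervalIntegral.integral_const_mul]
    refine intervalIntegral.integral_congr_Ioo_of_le hp.1 fun t ht => ?_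
    exact Q_of_map hc h (ht.2.trans_le hp.2)
  ext p
  rw [L, L, hG p p.2, hG 1 (by simp), mul_div_mul_left _ _ (NNReal.coe_pos.2 hc).ne']

end Dist

/-! ### Realising every element of `𝔏` -/

/-- A nondecreasing function on `(0, 1)` is almost everywhere the quantile function of its
distribution. -/
lemma quantile_map_ae_eq {f : ℝ → ℝ≥0} (hf : MonotoneOn f (Ioo 0 1))
    (hfi : ∫⁻ t in Ioo (0 : ℝ) 1, (f t : ℝ≥0∞) ≠ ∞) :
    quantile ((volume.restrict (Ioo (0 : ℝ) 1)).map f) =ᵐ[volume.restrict (Ioo 0 1)] f := by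
  have hm : AEMeasurable f (volume.restrict (Ioo 0 1)) :=
    aemeasurable_restrict_of_monotoneOn measurableSet_Ioo hf
  have : IsProbabilityMeasure (volume.restrict (Ioo (0 : ℝ) 1)) := ⟨by simp⟩
  set μ := (volume.restrict (Ioo (0 : ℝ) 1)).map f with hμ
  have : IsProbabilityMeasure μ := Measure.isProbabilityMeasure_map hm
  -- Since `f ≤ f t` on `(0, t]`, the law of `f` gives `[0, f t]` mass at least `t`.
  have hle : ∀ t ∈ Ioo (0 : ℝ) 1, quantile μ t ≤ f t := by
    intro t ht
    rw [quantile_le_iff μ ht.2, cdf, hμ, map_measureReal_apply_of_aemeasurable hm measurableSet_Iic]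
    have hsub : Ioc 0 t ⊆ f ⁻¹' Iic (f t) := fun s hs =>
      hf ⟨hs.1, hs.2.trans_lt ht.2⟩ ht hs.2
    refine le_trans (le_of_eq ?_) (measureReal_mono hsub)
    rw [measureReal_restrict_apply measurableSet_Ioc,
      inter_eq_left.2
        (show Ioc 0 t ⊆ Ioo 0 1 from fun s hs => ⟨hs.1, hs.2.trans_lt ht.2⟩)]
    simp [ht.1.le]
  -- Both functions push Lebesgue measure to `μ`, so their integrals agree; being finite, they turn
  -- the inequality `hle` into an a.e. equality.
  have hint : ∫⁻ t in Ioo (0 : ℝ) 1, (quantile μ t : ℝ≥0∞) =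
      ∫⁻ t in Ioo (0 : ℝ) 1, (f t : ℝ≥0∞) := by
    rw [lintegral_quantile, mean, hμ,
      lintegral_map' measurable_coe_nnreal_ennreal.aemeasurable hm]
  have := ae_eq_of_ae_le_of_lintegral_le (μ := volume.restrict (Ioo (0 : ℝ) 1))
    (f := fun t => (quantile μ t : ℝ≥0∞)) (g := fun t => (f t : ℝ≥0∞)) ?_ (by rwa [hint])
    hm.coe_nnreal_ennreal hint.ge
  · filter_upwards [this] with t ht
    exact ENNReal.coe_injective ht
  · filter_upwards [ae_restrict_mem measurableSet_Ioo] with t ht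
    exact ENNReal.coe_le_coe.2 (hle t ht)

/-- Convexity between `0` and `y` with `ℓ 0 = 0` gives `ℓ x ≤ (x / y) ℓ y ≤ ℓ y`. -/
lemma lorenzSet_subset_contMono : lorenzSet ⊆ contMono 0 1 := by
  rintro ℓ ⟨h01, hc, hconv, h0, -⟩
  refine ⟨hc, fun x y hxy => ?_⟩
  rcases eq_or_lt_of_le hxy with rfl | hlt
  · exact le_rfl
  have hlt' : (x : ℝ) < y := hlt
  have hy : (0 : ℝ) < y := x.2.1.trans_lt hlt'
  have hz : (0 : ℝ) ∈ Icc (0 : ℝ) 1 := by simp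
  have hd : (x : ℝ) / y ≤ 1 := (div_le_one hy).2 hlt'.le
  have hd0 : 0 ≤ (x : ℝ) / y := div_nonneg x.2.1 hy.le
  have := hconv.2 hz y.2 (sub_nonneg.2 hd) hd0 (sub_add_cancel 1 _)
  simp only [smul_eq_mul, mul_zero, zero_add, div_mul_cancel₀ _ hy.ne', IccExtend_val] at this
  rw [IccExtend_of_mem _ _ hz] at this
  have h0' : ℓ ⟨0, hz⟩ = 0 := h0
  rw [h0', mul_zero, zero_add] at this
  exact this.trans (mul_le_of_le_one_left (h01 y).1 hd)

/-- Every element of `𝔏` is the Lorenz function of a distribution with prescribed mean. -/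
lemma exists_dist {ℓ : Icc (0 : ℝ) 1 → ℝ} (hℓ : ℓ ∈ lorenzSet) (α : Ioi (0 : ℝ)) :
    ∃ μ : Dist, μ.L = ℓ ∧ μ.m = α := by
  have hmono := (lorenzSet_subset_contMono hℓ).2
  obtain ⟨h01, hc, hconv, h0, h1⟩ := hℓ
  have hα : (0 : ℝ) < α := α.2
  set g : ℝ → ℝ := IccExtend zero_le_one ℓ with hg
  have hgc : Continuous g := hc.Icc_extend'
  have hgm : Monotone g := hmono.IccExtend zero_le_one
  have hg0 : g 0 = 0 := by rw [hg, IccExtend_left]; exact h0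
  have hg1 : g 1 = 1 := by rw [hg, IccExtend_right]; exact h1
  set d : ℝ → ℝ := fun x => derivWithin g (Ioi x) x with hd
  have hder : ∀ x ∈ Ioo (0 : ℝ) 1, HasDerivWithinAt g (d x) (Ioi x) x := fun x hx =>
    hconv.hasDerivWithinAt_rightDeriv_of_mem_interior (by rwa [interior_Icc])
  have hdm : MonotoneOn d (Ioo 0 1) := by
    have := hconv.monotoneOn_rightDeriv
    rwa [interior_Icc] at this
  have hd0 : ∀ x, 0 ≤ d x := fun x => (hgm.monotoneOn _).derivWithin_nonneg
  -- `d` may be unbounded near `1`; its integrability comes from its sign and the continuity of `g`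
  -- up to the endpoints.
  have hdi : IntervalIntegrable d volume 0 1 :=
    (intervalIntegrable_iff_integrableOn_Ioc_of_le zero_le_one).2
      (intervalIntegral.integrableOn_deriv_right_of_nonneg hgc.continuousOn hder fun x _ => hd0 x)
  have hftc : ∀ p ∈ Icc (0 : ℝ) 1, ∫ t in (0 : ℝ)..p, d t = g p := by
    intro p hp
    rw [intervalIntegral.integral_eq_sub_of_hasDeriv_right_of_le hp.1 hgc.continuousOn
      (fun x hx => hder x ⟨hx.1, hx.2.trans_le hp.2⟩) (hdi.mono_set ?_), hg0, sub_zero]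
    rw [uIcc_of_le hp.1, uIcc_of_le zero_le_one]
    exact Icc_subset_Icc_right hp.2
  set f : ℝ → ℝ≥0 := fun x => Real.toNNReal (α * d x) with hf
  have hfd : ∀ x, (f x : ℝ) = α * d x := fun x => Real.coe_toNNReal _ (mul_nonneg hα.le (hd0 x))
  have hfm : MonotoneOn f (Ioo 0 1) := fun x hx y hy hxy =>
    Real.toNNReal_mono (mul_le_mul_of_nonneg_left (hdm hx hy hxy) hα.le)
  have hfl : ∫⁻ t in Ioo (0 : ℝ) 1, (f t : ℝ≥0∞) = ENNReal.ofReal α := by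
    have hi : Integrable (fun t => α * d t) (volume.restrict (Ioo 0 1)) :=
      (((intervalIntegrable_iff_integrableOn_Ioo_of_le zero_le_one).1 hdi).const_mul _)
    have := ofReal_integral_eq_lintegral_ofReal hi
      (Filter.Eventually.of_forall fun x => mul_nonneg hα.le (hd0 x))
    rw [integral_const_mul, ← integral_Ioc_eq_integral_Ioo,
      ← intervalIntegral.integral_of_le zero_le_one, hftc 1 (by simp), hg1, mul_one] at this
    exact this.symm
  have hq := quantile_map_ae_eq hfm (by rw [hfl]; exact ENNReal.ofReal_ne_top)
  have hm : AEMeasurable f (volume.restrict (Ioo 0 1)) :=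
    aemeasurable_restrict_of_monotoneOn measurableSet_Ioo hfm
  have : IsProbabilityMeasure (volume.restrict (Ioo (0 : ℝ) 1)) := ⟨by simp⟩
  have hmean : mean ((volume.restrict (Ioo (0 : ℝ) 1)).map f) = ENNReal.ofReal α := by
    rw [mean, lintegral_map' measurable_coe_nnreal_ennreal.aemeasurable hm, hfl]
  let μ : Dist :=
    { toMeasure := (volume.restrict (Ioo (0 : ℝ) 1)).map f
      isProb := Measure.isProbabilityMeasure_map hm
      mean_ne_zero := by rw [hmean]; exact (ENNReal.ofReal_pos.2 hα).ne'
      mean_ne_top := by rw [hmean]; exact ENNReal.ofReal_ne_top }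
  have hμm : μ.m = α := Subtype.ext (by
    change (mean _).toReal = _
    rw [hmean, ENNReal.toReal_ofReal hα.le])
  refine ⟨μ, funext fun p => ?_, hμm⟩
  have hae : ∀ᵐ t, t ∈ Ioc (0 : ℝ) p → μ.Q t = α * d t := by
    have h2 : ∀ᵐ t, t ∈ Ioo (0 : ℝ) 1 → quantile μ.toMeasure t = f t :=
      (ae_restrict_iff' measurableSet_Ioo).1 hq
    have h3 : ∀ᵐ t : ℝ, t ≠ 1 := by simp [ae_iff]
    filter_upwards [h2, h3] with t h2 h3 ht
    rw [← hfd, ← h2 ⟨ht.1, lt_of_le_of_ne (ht.2.trans p.2.2) h3⟩, Dist.Q]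
  have hae' : ∀ᵐ t, t ∈ uIoc (0 : ℝ) p → μ.Q t = α * d t := by rwa [uIoc_of_le p.2.1]
  rw [Dist.L_eq, hμm, intervalIntegral.integral_congr_ae hae',
    intervalIntegral.integral_const_mul, hftc p p.2, mul_div_cancel_left₀ _ hα.ne', hg,
    IccExtend_val]

/-! ### Pointwise and uniform convergence -/

/-- Pólya's theorem: on continuous nondecreasing functions on a segment, pointwise convergence
implies uniform convergence. -/
lemma continuous_ofFun_contMono {a b : ℝ} (hab : a ≤ b) :
    Continuous fun f : contMono a b => UniformFun.ofFun (f : Icc a b → ℝ) := by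
  rw [continuous_iff_continuousAt]
  intro f
  rw [ContinuousAt, UniformFun.tendsto_iff_tendstoUniformly, Metric.tendstoUniformly_iff]
  intro ε hε
  have hε4 : 0 < ε / 4 := by positivity
  -- Compactness yields a finite subdivision on whose cells `f` oscillates by less than `ε / 2`.
  obtain ⟨t, ht0, -, ⟨m, hm⟩, ht⟩ := exists_monotone_Icc_subset_open_cover_Icc hab
    (c := fun x : Icc a b => {y | |f.1 y - f.1 x| < ε / 4})
    (fun x => isOpen_lt (f.2.1.sub continuous_const).abs continuous_const)
    (fun x _ => mem_iUnion.2 ⟨x, by simpa using hε4⟩)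
  have hosc : ∀ n, ∀ x ∈ Icc (t n) (t (n + 1)), ∀ y ∈ Icc (t n) (t (n + 1)),
      f.1 x < f.1 y + ε / 2 := by
    intro n x hx y hy
    obtain ⟨i, hi⟩ := ht n
    have hx' : |f.1 x - f.1 i| < ε / 4 := hi hx
    have hy' : |f.1 y - f.1 i| < ε / 4 := hi hy
    have h1 := abs_lt.1 hx'
    have h2 := abs_lt.1 hy'
    linarith [h1.2, h2.1]
  have hloc : ∀ x : Icc a b, ∃ n < m + 1, x ∈ Icc (t n) (t (n + 1)) := by
    intro x
    have hex : ∃ n, x ≤ t n := ⟨m, by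
      have : (x : ℝ) ≤ t m := by rw [hm m le_rfl]; exact x.2.2
      exact this⟩
    classical
    have hfind : Nat.find hex ≤ m := Nat.find_min' hex (by
      have : (x : ℝ) ≤ t m := by rw [hm m le_rfl]; exact x.2.2
      exact this)
    rcases Nat.eq_zero_or_pos (Nat.find hex) with h0 | h0
    · have hx0 : x ≤ t 0 := h0 ▸ Nat.find_spec hex
      have hx : x = t 0 := le_antisymm hx0 (by
        have : (t 0 : ℝ) ≤ x := by rw [ht0]; exact x.2.1
        exact this)
      refine ⟨0, by omega, hx.ge, ?_⟩
      have : (t 0 : ℝ) ≤ t (0 + 1) := by rw [ht0]; exact (t 1).2.1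
      exact hx.le.trans this
    · obtain ⟨k, hk⟩ := Nat.exists_eq_succ_of_ne_zero h0.ne'
      refine ⟨k, by omega, ?_, ?_⟩
      · exact (not_le.1 (Nat.find_min hex (m := k) (by omega))).le
      · exact hk.subst (motive := fun j => x ≤ t j) (Nat.find_spec hex)
  have hev : ∀ x : Icc a b, ∀ᶠ g : contMono a b in 𝓝 f, |g.1 x - f.1 x| < ε / 4 := by
    intro x
    have hc : Continuous fun g : contMono a b => |g.1 x - f.1 x| :=
      (((continuous_apply x).comp continuous_subtype_val).sub continuous_const).abs
    exact hc.continuousAt.eventually_lt continuousAt_const (by simpa using hε4)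
  -- Cells are indexed by `n < m + 1` and have right end `t (n + 1)`, so the nodes `0, …, m + 1` are
  -- controlled. Monotonicity then traps `g x` between its values at the two ends of the cell, with
  -- total error below `ε / 4 + ε / 2`.
  have hall : ∀ᶠ g : contMono a b in 𝓝 f, ∀ n ∈ Finset.range (m + 2),
      |g.1 (t n) - f.1 (t n)| < ε / 4 :=
    (Finset.eventually_all _).2 fun n _ => hev (t n)
  filter_upwards [hall] with g hg x
  obtain ⟨n, hn, hx⟩ := hloc x
  have h1 := abs_lt.1 (hg n (Finset.mem_range.2 (by omega)))
  have h2 := abs_lt.1 (hg (n + 1) (Finset.mem_range.2 (by omega)))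
  have hl : t n ∈ Icc (t n) (t (n + 1)) := left_mem_Icc.2 (hx.1.trans hx.2)
  have hr : t (n + 1) ∈ Icc (t n) (t (n + 1)) := right_mem_Icc.2 (hx.1.trans hx.2)
  have h3 := hosc n x hx _ hl
  have h4 := hosc n _ hr x hx
  have h5 := g.2.2 hx.1
  have h6 := g.2.2 hx.2
  change |f.1 x - g.1 x| < ε
  rw [abs_lt]
  constructor <;> linarith [h1.1, h2.2]

lemma induced_unif_eq_induced_pointwise {a b : ℝ} (hab : a ≤ b) :
    TopologicalSpace.induced (fun f : contMono a b => UniformFun.ofFun (f : Icc a b → ℝ))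
      (inferInstance : TopologicalSpace (UniformFun (Icc a b) ℝ)) =
    TopologicalSpace.induced (fun f : contMono a b => (f : Icc a b → ℝ))
      (inferInstance : TopologicalSpace (Icc a b → ℝ)) := by
  refine le_antisymm ?_ (continuous_iff_le_induced.1 (continuous_ofFun_contMono hab))
  have h : Continuous (UniformFun.toFun : UniformFun (Icc a b) ℝ → Icc a b → ℝ) :=
    UniformFun.uniformContinuous_toFun.continuous
  have := induced_mono (g := fun f : contMono a b => UniformFun.ofFun (f : Icc a b → ℝ))
    (continuous_iff_le_induced.1 h)
  rwa [induced_compose] at this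

/-- Uniform and pointwise convergence coincide on `𝔏`. -/
def unifLorenzHomeomorph : lorenzSet ≃ₜ unif lorenzSet where
  toFun ℓ := ⟨UniformFun.ofFun ℓ.1, ℓ.2⟩
  invFun ℓ := ⟨UniformFun.toFun ℓ.1, ℓ.2⟩
  left_inv _ := rfl
  right_inv _ := rfl
  continuous_toFun := ((continuous_ofFun_contMono zero_le_one).comp
    (continuous_inclusion lorenzSet_subset_contMono)).subtype_mk _
  continuous_invFun := (UniformFun.uniformContinuous_toFun.continuous.comp
    continuous_subtype_val).subtype_mk _

/-! ### Continuity in both directions, and the homeomorphisms -/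

namespace Dist

lemma dist_eq_W₁ (μ ν : Dist) : dist μ ν = W₁ μ ν := rfl

/-- The map is `1`-Lipschitz for `W₁`; this carries the continuity of both `m` and `L`. -/
lemma continuous_integral_Q {p : ℝ} (hp : p ∈ Icc (0 : ℝ) 1) :
    Continuous fun μ : Dist => ∫ t in (0 : ℝ)..p, μ.Q t := by
  have hz : (0 : ℝ) ∈ Icc (0 : ℝ) 1 := by simp
  refine (LipschitzWith.of_dist_le_mul (K := 1) fun μ ν => ?_).continuous
  rw [NNReal.coe_one, one_mul, dist_eq_W₁, Real.dist_eq,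
    ← intervalIntegral.integral_sub (μ.intervalIntegrable_Q hz hp) (ν.intervalIntegrable_Q hz hp)]
  refine (intervalIntegral.abs_integral_le_integral_abs hp.1).trans ?_
  exact intervalIntegral.integral_mono_interval le_rfl hp.1 hp.2
    (Filter.Eventually.of_forall fun t => abs_nonneg _)
    ((μ.intervalIntegrable_Q hz (by simp)).sub (ν.intervalIntegrable_Q hz (by simp))).abs

lemma continuous_m : Continuous m := by
  refine Continuous.subtype_mk (f := fun μ : Dist => (mean μ.toMeasure).toReal) ?_ _
  have : (fun μ : Dist => (mean μ.toMeasure).toReal) = fun μ => ∫ t in (0 : ℝ)..1, μ.Q t :=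
    funext fun μ => μ.integral_Q_eq_m.symm
  rw [this]
  exact continuous_integral_Q (by simp)

lemma continuous_L : Continuous L := by
  refine continuous_pi fun p => ?_
  simp only [L_eq]
  exact (continuous_integral_Q p.2).div (continuous_subtype_val.comp continuous_m)
    fun μ => μ.m_pos.ne'

/-- Pointwise convergence of the Lorenz functions and convergence of the means imply `W₁`
convergence. -/
lemma tendsto_of_L_of_m {ι : Type*} {F : Filter ι} {u : ι → Dist} {μ : Dist}
    (hL : ∀ p, Filter.Tendsto (fun i => (u i).L p) F (𝓝 (μ.L p)))
    (hm : Filter.Tendsto (fun i => ((u i).m : ℝ)) F (𝓝 μ.m)) : Filter.Tendsto u F (𝓝 μ) := by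
  have hI : ∀ a ∈ Icc (0 : ℝ) 1, ∀ b ∈ Icc (0 : ℝ) 1,
      Filter.Tendsto (fun i => ∫ t in a..b, (u i).Q t) F (𝓝 (∫ t in a..b, μ.Q t)) := by
    intro a ha b hb
    simp only [integral_Q_sub _ ha hb]
    exact (hm.mul (hL _)).sub (hm.mul (hL _))
  rw [Metric.tendsto_nhds]
  intro ε hε
  -- The subdivision depends on `μ` alone: the tail of `u i` converges to that of `μ`, so the bound
  -- tends to `(2 + 2)` times the tail of `μ`, whence `ε / 4`.
  obtain ⟨n, hn⟩ := ((tendsto_tail μ.integrable_Q).eventually_lt_const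
    (show 0 < ε / 4 by positivity)).exists
  have hB : Filter.Tendsto (fun i => (∑ j ∈ Finset.range n,
      |(∫ t in node n j..node n (j + 1), (u i).Q t) - ∫ t in node n j..node n (j + 1), μ.Q t|) +
      2 * (∫ t in node n n..1, (u i).Q t) + 2 * ∫ t in node n n..1, μ.Q t) F
      (𝓝 (4 * ∫ t in node n n..1, μ.Q t)) := by
    have h1 : Filter.Tendsto (fun i => ∑ j ∈ Finset.range n,
        |(∫ t in node n j..node n (j + 1), (u i).Q t) - ∫ t in node n j..node n (j + 1), μ.Q t|)
        F (𝓝 (∑ j ∈ Finset.range n, 0)) := by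
      refine tendsto_finsetSum _ fun j hj => ?_
      have hj' := Finset.mem_range.1 hj
      simpa using ((hI _ (node_mem n j (by omega)) _ (node_mem n (j + 1) (by omega))).sub_const
        (∫ t in node n j..node n (j + 1), μ.Q t)).abs
    have h2 := (h1.add ((hI _ (node_mem n n (by omega)) 1 (by simp)).const_mul 2)).add_const
      (2 * ∫ t in node n n..1, μ.Q t)
    convert h2 using 2
    rw [Finset.sum_const_zero]
    ring
  filter_upwards [hB.eventually_lt_const (show _ < ε by linarith)] with i hi
  rw [dist_eq_W₁]
  exact (integral_abs_sub_le_sum (u i).Q_monotoneOn μ.Q_monotoneOn (u i).Q_nonneg μ.Q_nonneg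
    (u i).integrable_Q μ.integrable_Q n).trans_lt hi

/-- The distribution with a given Lorenz function and a given mean. -/
def ofLorenz (x : lorenzSet × Ioi (0 : ℝ)) : Dist := (exists_dist x.1.2 x.2).choose

lemma L_ofLorenz (x : lorenzSet × Ioi (0 : ℝ)) : (ofLorenz x).L = x.1 :=
  (exists_dist x.1.2 x.2).choose_spec.1

lemma m_ofLorenz (x : lorenzSet × Ioi (0 : ℝ)) : (ofLorenz x).m = x.2 :=
  (exists_dist x.1.2 x.2).choose_spec.2

/-- The Lorenz function and the mean, as a homeomorphism, for the topology of pointwise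
convergence. -/
def lorenzHomeomorph : Dist ≃ₜ lorenzSet × Ioi (0 : ℝ) where
  toFun μ := (⟨μ.L, μ.L_mem⟩, μ.m)
  invFun := ofLorenz
  left_inv μ := eq_of_L_eq_of_m_eq (L_ofLorenz _) (m_ofLorenz _)
  right_inv x := Prod.ext (Subtype.ext (L_ofLorenz x)) (m_ofLorenz x)
  continuous_toFun := (continuous_L.subtype_mk _).prodMk continuous_m
  continuous_invFun := by
    refine continuous_iff_continuousAt.2 fun x => tendsto_of_L_of_m (fun p => ?_) ?_
    · simp only [L_ofLorenz]
      exact ((continuous_apply p).comp (continuous_subtype_val.comp continuous_fst)).continuousAt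
    · simp only [m_ofLorenz]
      exact (continuous_subtype_val.comp continuous_snd).continuousAt

/-- The Lorenz function of a class of distributions modulo rescaling, as a homeomorphism, for the
topology of pointwise convergence. -/
def classesHomeomorph : Classes ≃ₜ lorenzSet where
  toFun := Quotient.lift (fun μ : Dist => (⟨μ.L, μ.L_mem⟩ : lorenzSet))
    fun _ _ h => Subtype.ext (L_eq_of_equiv h)
  -- The choice of mean `1` is an arbitrary continuous section; another mean gives the same class.
  invFun ℓ := Quotient.mk _ (ofLorenz (ℓ, ⟨1, mem_Ioi.2 one_pos⟩))
  left_inv c := by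
    induction c using Quotient.inductionOn with
    | h μ => exact Quotient.sound (equiv_of_L_eq (L_ofLorenz _))
  right_inv ℓ := Subtype.ext (L_ofLorenz _)
  continuous_toFun := (continuous_L.subtype_mk _).quotient_lift _
  continuous_invFun := continuous_quotient_mk'.comp
    (lorenzHomeomorph.symm.continuous.comp
      (continuous_id.prodMk (continuous_const (y := (⟨1, mem_Ioi.2 one_pos⟩ : Ioi (0 : ℝ))))))

lemma isHomeomorph_mk_m : IsHomeomorph fun μ : Dist => ((Quotient.mk _ μ : Classes), μ.m) := by
  refine isHomeomorph_iff_exists_inverse.2 ⟨continuous_quotient_mk'.prodMk continuous_m,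
    fun x => ofLorenz (classesHomeomorph x.1, x.2), fun μ => ?_, fun x => ?_, ?_⟩
  · exact lorenzHomeomorph.symm_apply_apply μ
  · refine Prod.ext (classesHomeomorph.injective (Subtype.ext ?_)) (m_ofLorenz _)
    exact L_ofLorenz _
  · exact lorenzHomeomorph.symm.continuous.comp
      ((classesHomeomorph.continuous.comp continuous_fst).prodMk continuous_snd)

/-- This is the slice of `lorenzHomeomorph` with the second coordinate frozen at `α`, read through
`classesHomeomorph`. -/
lemma isHomeomorph_withMean (α : Ioi (0 : ℝ)) :
    IsHomeomorph fun μ : withMean α => (Quotient.mk _ (μ : Dist) : Classes) := by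
  refine isHomeomorph_iff_exists_inverse.2 ⟨continuous_quotient_mk'.comp continuous_subtype_val,
    fun c => ⟨ofLorenz (classesHomeomorph c, α), m_ofLorenz _⟩, fun μ => Subtype.ext ?_,
    fun c => ?_, ?_⟩
  · exact eq_of_L_eq_of_m_eq (L_ofLorenz _) ((m_ofLorenz _).trans μ.2.symm)
  · exact classesHomeomorph.injective (Subtype.ext (L_ofLorenz _))
  · exact (lorenzHomeomorph.symm.continuous.comp
      (classesHomeomorph.continuous.prodMk continuous_const)).subtype_mk _

/-- The complementary slice: an equivalence class is a fibre of `L`, on which the mean is the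
remaining coordinate. -/
lemma isHomeomorph_cls (μ : Dist) : IsHomeomorph fun ν : cls μ => (ν : Dist).m := by
  refine isHomeomorph_iff_exists_inverse.2 ⟨continuous_m.comp continuous_subtype_val,
    fun r => ⟨ofLorenz (⟨μ.L, μ.L_mem⟩, r), equiv_of_L_eq (L_ofLorenz _)⟩,
    fun ν => Subtype.ext ?_, fun r => m_ofLorenz _, ?_⟩
  · exact eq_of_L_eq_of_m_eq ((L_ofLorenz _).trans (L_eq_of_equiv ν.2).symm) (m_ofLorenz _)
  · exact (lorenzHomeomorph.symm.continuous.comp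
      (continuous_const.prodMk continuous_id)).subtype_mk _

end Dist

end Lorenz

end

theorem mainTheorem6 :
    -- `μ ↦ (L_μ, m_μ)` is a homeomorphism `(𝐌, W₁) ≈ (𝔏, ‖·‖_∞) × ℝ₊*`
    (∃ Φ : Lorenz.Dist ≃ₜ Lorenz.unif Lorenz.lorenzSet × Set.Ioi (0 : ℝ),
      ∀ μ : Lorenz.Dist,
        UniformFun.toFun ((Φ μ).1 : UniformFun (Set.Icc (0 : ℝ) 1) ℝ) = μ.L ∧ (Φ μ).2 = μ.m) ∧
    -- the same with the topology of pointwise convergence on `𝔏`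
    (∃ Φ : Lorenz.Dist ≃ₜ Lorenz.lorenzSet × Set.Ioi (0 : ℝ),
      ∀ μ : Lorenz.Dist,
        ((Φ μ).1 : Set.Icc (0 : ℝ) 1 → ℝ) = μ.L ∧ (Φ μ).2 = μ.m) ∧
    -- uniform and pointwise convergence induce the same topology on `𝒞↑`, which contains `𝔏`
    (∀ a b : ℝ, a ≤ b →
      TopologicalSpace.induced
          (fun f : Lorenz.contMono a b => UniformFun.ofFun (f : Set.Icc a b → ℝ))
          (inferInstance : TopologicalSpace (UniformFun (Set.Icc a b) ℝ)) =
        TopologicalSpace.induced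
          (fun f : Lorenz.contMono a b => (f : Set.Icc a b → ℝ))
          (inferInstance : TopologicalSpace (Set.Icc a b → ℝ))) ∧
    Lorenz.lorenzSet ⊆ Lorenz.contMono 0 1 ∧
    -- `[μ] ↦ L_μ` is a homeomorphism `𝐌 / ℝ₊* ≈ 𝔏`
    (∃ Ψ : Lorenz.Dist.Classes ≃ₜ Lorenz.unif Lorenz.lorenzSet,
      ∀ μ : Lorenz.Dist,
        UniformFun.toFun (Ψ (Quotient.mk _ μ) : UniformFun (Set.Icc (0 : ℝ) 1) ℝ) = μ.L) ∧
    -- `μ ↦ ([μ], m_μ)` is a homeomorphism `𝐌 ≈ 𝐌 / ℝ₊* × ℝ₊*`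
    IsHomeomorph (fun μ : Lorenz.Dist => ((Quotient.mk _ μ : Lorenz.Dist.Classes), μ.m)) ∧
    -- `μ ↦ [μ]` is a homeomorphism `𝐌_α ≈ 𝐌 / ℝ₊*` for every `α > 0`
    (∀ α : Set.Ioi (0 : ℝ),
      IsHomeomorph (fun μ : Lorenz.Dist.withMean α =>
        (Quotient.mk _ (μ : Lorenz.Dist) : Lorenz.Dist.Classes))) ∧
    -- `ν ↦ m_ν` is a homeomorphism `[μ] ≈ ℝ₊*` for every `μ ∈ 𝐌`
    (∀ μ : Lorenz.Dist,
      IsHomeomorph (fun ν : Lorenz.Dist.cls μ => (ν : Lorenz.Dist).m)) := by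
  refine ⟨⟨Lorenz.Dist.lorenzHomeomorph.trans
      (Lorenz.unifLorenzHomeomorph.prodCongr (Homeomorph.refl _)), fun μ => ⟨rfl, rfl⟩⟩,
    ⟨Lorenz.Dist.lorenzHomeomorph, fun μ => ⟨rfl, rfl⟩⟩,
    fun a b hab => Lorenz.induced_unif_eq_induced_pointwise hab,
    Lorenz.lorenzSet_subset_contMono,
    ⟨Lorenz.Dist.classesHomeomorph.trans Lorenz.unifLorenzHomeomorph, fun μ => rfl⟩,
    Lorenz.Dist.isHomeomorph_mk_m, Lorenz.Dist.isHomeomorph_withMean,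
    Lorenz.Dist.isHomeomorph_cls⟩
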